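/- Let $V:\mathbb R\to\mathbb R$ be $C^2$, let $\omega_b>0$ and $T=2\pi/\omega_b$, and let $u$ be a time-symmetric periodic orbit of frequency $\omega_b$ of the isolated oscillator $$\ddot u+V'(u)=0,$$ that is, a non-constant, even, $T$-periodic $C^2$ solution. Suppose that $u=u_{\omega_b}$ belongs to a family $u_\omega$, $\omega$ near $\omega_b$, where $u_\omega$ is a non-constant, even, $2\pi/\omega$-periodic $C^2$ solution, such that $\omega\mapsto u_\omega(0)$ is continuous at $\omega_b$ and the energy $H(\omega)=\tfrac12\dot u_\omega^2+V(u_\omega)$ is differentiable at $\omega_b$ with derivative $dH/d\omega_b$. For $E\in\mathbb R$ let $F_E$ be the Floquet operator $\xi(t)\mapsto\xi(t+T)$ on the space of complex $C^2$ solutions of $$\mathcal N\xi\equiv\ddot\xi+V''(u)\,\xi=E\,\xi ,$$ and let $\mathcal B$ be the set of all $(\theta,E)\in\mathbb R^2$ such that $e^{i\theta}$ is an eigenvalue of $F_E$. Put $I=\int_0^T\dot u^2\,dt$. Then $I>0$ and there is a function $E(\theta)$ such that, in a neighbourhood of $(0,0)$, the set $\mathcal B$ is exactly the graph of $E$. It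 satisfies $E(0)=0$; near $\theta=0$ it is even and differentiable; $E_\theta(0)=0$; and it is twice differentiable at $0$ with $$E_{\theta\theta}(0)=-\frac{\omega_b^2}{\pi I}\,\frac{dH}{d\omega_b}.$$ Consequently, if $V$ is hard at this orbit ($dH/d\omega_b>0$), then $E_{\theta\theta}(0)<0$ and the band is tangent to the axis $E=0$ from below ($E(\theta)<0$ for all small $\theta\ne0$); if $V$ is soft ($dH/d\omega_b<0$), then $E_{\theta\theta}(0)>0$ and the band is tangent to the axis from above ($E(\theta)>0$ for all small $\theta\neq0$). -/

import Mathlib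

open Filter Topology

namespace BandCurvature

/-- `u` is a time-symmetric (even), non-constant, `T`-periodic `C²` solution of
`u'' + V'(u) = 0`. -/
structure IsSymmetricPeriodicOrbit (V : ℝ → ℝ) (T : ℝ) (u : ℝ → ℝ) : Prop where
  contDiff : ContDiff ℝ 2 u
  dynamics : ∀ t, deriv (deriv u) t + deriv V (u t) = 0
  even : ∀ t, u (-t) = u t
  periodic : Function.Periodic u T
  nonconstant : ∃ t, u t ≠ u 0

/-- The Hamiltonian `H = p² / 2 + V(u)` of the isolated oscillator. -/
noncomputable def hamiltonian (V : ℝ → ℝ) (q p : ℝ) : ℝ := p ^ 2 / 2 + V q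

/-- The energy of an orbit; it is conserved, so it is read off at time `0`. -/
noncomputable def orbitEnergy (V : ℝ → ℝ) (u : ℝ → ℝ) : ℝ :=
  hamiltonian V (u 0) (deriv u 0)

/-- The Newton operator `N ξ = ξ'' + V''(u) ξ`. -/
noncomputable def newtonOperator (V : ℝ → ℝ) (u : ℝ → ℝ) (ξ : ℝ → ℂ) (t : ℝ) : ℂ :=
  deriv (deriv ξ) t + ((deriv (deriv V) (u t) : ℝ) : ℂ) * ξ t

/-- The complex vector space of `C²` solutions of `N ξ = E ξ`. -/
noncomputable def newtonSpace (V : ℝ → ℝ) (u : ℝ → ℝ) (E : ℝ) : Submodule ℂ (ℝ → ℂ) where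
  carrier := {ξ | ContDiff ℝ 2 ξ ∧ ∀ t, newtonOperator V u ξ t = (E : ℂ) * ξ t}
  zero_mem' := by
    refine ⟨contDiff_const, fun t => ?_⟩
    have h : deriv (0 : ℝ → ℂ) = 0 := by
      funext s
      exact deriv_const s (0 : ℂ)
    simp [newtonOperator, h]
  add_mem' := by
    rintro f g ⟨hf, hf'⟩ ⟨hg, hg'⟩
    refine ⟨hf.add hg, fun t => ?_⟩
    have h1 : deriv (f + g) = deriv f + deriv g := by
      funext s
      exact deriv_add (hf.differentiable (by norm_num) s) (hg.differentiable (by norm_num) s)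
    have h2 : deriv (deriv f + deriv g) t = deriv (deriv f) t + deriv (deriv g) t :=
      deriv_add (hf.differentiable_deriv_two t) (hg.differentiable_deriv_two t)
    have hft := hf' t
    have hgt := hg' t
    simp only [newtonOperator] at hft hgt ⊢
    rw [h1, h2]
    simp only [Pi.add_apply]
    linear_combination hft + hgt
  smul_mem' := by
    rintro c f ⟨hf, hf'⟩
    refine ⟨contDiff_const.smul hf, fun t => ?_⟩
    have h1 : deriv (c • f) = c • deriv f := by
      funext s
      exact deriv_const_smul c (hf.differentiable (by norm_num) s)
    have h2 : deriv (c • deriv f) t = c • deriv (deriv f) t :=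
      deriv_const_smul c (hf.differentiable_deriv_two t)
    have hft := hf' t
    simp only [newtonOperator] at hft ⊢
    rw [h1, h2]
    simp only [Pi.smul_apply, smul_eq_mul]
    linear_combination c * hft

/-- Solutions of `N ξ = E ξ` are preserved by the translation of time by one period. -/
theorem translate_mem_newtonSpace {V u : ℝ → ℝ} {T : ℝ} (hu : Function.Periodic u T) {E : ℝ}
    {ξ : ℝ → ℂ} (hξ : ξ ∈ newtonSpace V u E) : (fun t => ξ (t + T)) ∈ newtonSpace V u E := by
  obtain ⟨h1, h2⟩ := hξ
  refine ⟨h1.comp (contDiff_id.add contDiff_const), fun t => ?_⟩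
  have h3 : deriv (fun t => ξ (t + T)) = fun t => deriv ξ (t + T) := by
    funext s
    exact deriv_comp_add_const ξ T s
  have h4 := h2 (t + T)
  simp only [newtonOperator] at h4 ⊢
  rw [h3, deriv_comp_add_const, ← h4, hu t]

/-- The Floquet operator `F_E`, which maps `ξ(t)` to `ξ(t + T)` on the solutions of
`N ξ = E ξ`. -/
noncomputable def floquetOperator (V : ℝ → ℝ) (u : ℝ → ℝ) (T : ℝ) (hu : Function.Periodic u T)
    (E : ℝ) : Module.End ℂ (newtonSpace V u E) where
  toFun ξ := ⟨fun t => (ξ : ℝ → ℂ) (t + T), translate_mem_newtonSpace hu ξ.2⟩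
  map_add' _ _ := rfl
  map_smul' _ _ := rfl

/-- The band set: all real points `(θ, E)` such that `θ` is a Floquet argument of `F_E`, that is,
`exp (iθ)` is an eigenvalue (Floquet multiplier) of `F_E`. -/
def bandSet (V : ℝ → ℝ) (u : ℝ → ℝ) (T : ℝ) (hu : Function.Periodic u T) : Set (ℝ × ℝ) :=
  {p | (floquetOperator V u T hu p.2).HasEigenvalue (Complex.exp (Complex.I * (p.1 : ℂ)))}

end BandCurvature

/-!
The multiplier condition becomes an equation for the discriminant of Hill's equation. Let
`q = V''(u)`, which is even and `T`-periodic, and let `c_E`, `s_E` be the fundamental solutions of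
`ξ'' + q ξ = E ξ`. The monodromy matrix has determinant one, and its diagonal entries agree because
`q` is even, so `exp (iθ)` is a multiplier exactly when `c_E(T) = cos θ` (`mem_bandSet_iff`). The
function `D(E) = c_E(T)` is continuously differentiable (`hasDerivAt_halfDiscriminant`), and
`D(0) = 1` because the velocity `u'` is a periodic solution at `E = 0`. If `D'(0) ≠ 0`, the band is
therefore the graph of `D⁻¹ ∘ cos`, whose second derivative at `0` is `-1 / D'(0)`
(`exists_band_function`).

It remains to compute `D'(0)`. At `E = 0` the second fundamental solution `s` is a multiple of `u'`
and the monodromy matrix is unipotent, with off-diagonal entry `m = c'(T)`. A reflection of the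
period interval turns the formula for `D'(0)` into `D'(0) = -m I / (2 V'(u(0))²)`
(`IsHillBasis.integral_mul_eq`). The entry `m` is found from the family of orbits: the energy
determines the amplitude `U w 0`, so this is differentiable, with derivative `dH / V'(u(0))`. The
difference of two nearby orbits solves Hill's equation up to an error of higher order, so its
Wronskian with `c` at time `2π / w` is `o(w - ωb)`. Both the orbit and its velocity are known at
that time, and differentiation gives `m dH = -(2π / ωb²) V'(u(0))²` (`monodromy_mul_energy_deriv`). In
particular `m` and `dH` do not vanish, and `D'(0) dH = π I / ωb²`.

All uses of differential equations go through Wronskians, except for the existence of `c_E`, `s_E`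
(a Picard series) and the continuous dependence of orbits on their initial point (Grönwall).
-/

namespace BandCurvature

/-! ### Linear differential equations with bounded coefficients -/

section LinearODE

variable {X : Type*} [NormedAddCommGroup X] [NormedSpace ℝ X]

/-- The terms of the Picard (Dyson) series of `Y' = A(t) Y`, `Y(0) = x`. -/
noncomputable def picardTerm (A : ℝ → X →L[ℝ] X) (x : X) : ℕ → ℝ → X
  | 0 => fun _ => x
  | n + 1 => fun t => ∫ s in (0 : ℝ)..t, A s (picardTerm A x n s)

theorem continuous_picardTerm [CompleteSpace X] {A : ℝ → X →L[ℝ] X} (hA : Continuous A) (x : X)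
    (n : ℕ) : Continuous (picardTerm A x n) := by
  induction n with
  | zero => exact continuous_const
  | succ n ih =>
    refine intervalIntegral.continuous_primitive (fun a b => ?_) 0
    exact (hA.clm_apply ih).intervalIntegrable a b

theorem hasDerivAt_picardTerm_succ [CompleteSpace X] {A : ℝ → X →L[ℝ] X} (hA : Continuous A)
    (x : X) (n : ℕ) (t : ℝ) :
    HasDerivAt (picardTerm A x (n + 1)) (A t (picardTerm A x n t)) t :=
  (hA.clm_apply (continuous_picardTerm hA x n)).integral_hasStrictDerivAt 0 t |>.hasDerivAt

theorem norm_picardTerm_le [CompleteSpace X] {A : ℝ → X →L[ℝ] X} (hA : Continuous A) {M : ℝ}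
    (hM : ∀ t, ‖A t‖ ≤ M) (x : X) (n : ℕ) (t : ℝ) :
    ‖picardTerm A x n t‖ ≤ ‖x‖ * ((M * |t|) ^ n / n.factorial) := by
  have hM0 : 0 ≤ M := (norm_nonneg _).trans (hM 0)
  induction n generalizing t with
  | zero => simp [picardTerm]
  | succ n ih =>
    have hc : Continuous fun s => A s (picardTerm A x n s) :=
      hA.clm_apply (continuous_picardTerm hA x n)
    have hi : ∀ f : ℝ → ℝ, Continuous f → MeasureTheory.IntegrableOn f (Set.uIoc 0 t) :=
      fun f hf => (hf.intervalIntegrable 0 t).def'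
    calc ‖picardTerm A x (n + 1) t‖
        ≤ ∫ s in Set.uIoc 0 t, ‖A s (picardTerm A x n s)‖ :=
          intervalIntegral.norm_integral_le_integral_norm_uIoc
      _ ≤ ∫ s in Set.uIoc 0 t, M ^ (n + 1) * ‖x‖ / n.factorial * |s - 0| ^ n := by
          refine MeasureTheory.setIntegral_mono (hi _ hc.norm) (hi _ (by fun_prop)) fun s => ?_
          calc ‖A s (picardTerm A x n s)‖ ≤ ‖A s‖ * ‖picardTerm A x n s‖ := (A s).le_opNorm _
            _ ≤ M * (‖x‖ * ((M * |s|) ^ n / n.factorial)) :=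
              mul_le_mul (hM s) (ih s) (norm_nonneg _) hM0
            _ = M ^ (n + 1) * ‖x‖ / n.factorial * |s - 0| ^ n := by
              rw [sub_zero]; ring
      _ = ‖x‖ * ((M * |t|) ^ (n + 1) / (n + 1).factorial) := by
          rw [MeasureTheory.integral_const_mul, integral_pow_abs_sub_uIoc, sub_zero,
            Nat.factorial_succ]
          push_cast
          field_simp
          ring

/-- A linear differential equation `Y' = A(t) Y` whose coefficient is continuous and bounded has a
solution on the whole line with any given initial value. -/
theorem exists_linear_ode_solution [CompleteSpace X] {A : ℝ → X →L[ℝ] X} (hA : Continuous A)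
    {M : ℝ} (hM : ∀ t, ‖A t‖ ≤ M) (x : X) :
    ∃ Y : ℝ → X, Y 0 = x ∧ ∀ t, HasDerivAt Y (A t (Y t)) t := by
  have hM0 : 0 ≤ M := (norm_nonneg _).trans (hM 0)
  have hsum : ∀ t, Summable fun n => picardTerm A x n t := fun t =>
    .of_norm_bounded ((Real.summable_pow_div_factorial (M * |t|)).mul_left ‖x‖)
      (norm_picardTerm_le hA hM x · t)
  refine ⟨fun t => x + ∑' n, picardTerm A x (n + 1) t, ?_, fun t => ?_⟩
  · simp [picardTerm]
  have hY : (x + ∑' n, picardTerm A x (n + 1) t) = ∑' n, picardTerm A x n t :=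
    ((hsum t).tsum_eq_zero_add).symm
  have hmain : HasDerivAt (fun t => ∑' n, picardTerm A x (n + 1) t)
      (∑' n, A t (picardTerm A x n t)) t := by
    have hbound : ∀ n, ∀ y ∈ Metric.ball (0 : ℝ) (|t| + 1), ‖A y (picardTerm A x n y)‖ ≤
        M * (‖x‖ * ((M * (|t| + 1)) ^ n / n.factorial)) := fun n y hy => by
      have hy' : |y| ≤ |t| + 1 := by simpa using (Metric.mem_ball.1 hy).le
      calc ‖A y (picardTerm A x n y)‖ ≤ ‖A y‖ * ‖picardTerm A x n y‖ := (A y).le_opNorm _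
        _ ≤ M * (‖x‖ * ((M * |y|) ^ n / n.factorial)) :=
          mul_le_mul (hM y) (norm_picardTerm_le hA hM x n y) (norm_nonneg _) hM0
        _ ≤ _ := by gcongr
    have hu : Summable fun n : ℕ => M * (‖x‖ * ((M * (|t| + 1)) ^ n / n.factorial)) :=
      ((Real.summable_pow_div_factorial _).mul_left _).mul_left _
    have h0 : (0 : ℝ) ∈ Metric.ball (0 : ℝ) (|t| + 1) := Metric.mem_ball_self (by positivity)
    have ht : t ∈ Metric.ball (0 : ℝ) (|t| + 1) := by simp
    exact hasDerivAt_tsum_of_isPreconnected hu Metric.isOpen_ball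
      (convex_ball _ _).isPreconnected (fun n y _ => hasDerivAt_picardTerm_succ hA x n y)
      hbound h0 ((summable_nat_add_iff 1).2 (hsum 0)) ht
  beta_reduce
  rw [hY, (A t).map_tsum (hsum t)]
  exact hmain.const_add x

end LinearODE

/-! ### Hill's equation and its Wronskian identities -/

section Hill

variable {F : Type*} [NormedAddCommGroup F] [NormedSpace ℝ F]

/-- `y` solves Hill's equation `y'' + q y = E y`, and `y'` is its derivative. -/
structure IsHillSolution (q : ℝ → ℝ) (E : ℝ) (y y' : ℝ → F) : Prop where
  hasDerivAt : ∀ t, HasDerivAt y (y' t) t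
  hasDerivAt' : ∀ t, HasDerivAt y' ((E - q t) • y t) t

/-- `c` and `s` are the fundamental solutions of Hill's equation, with the initial values
`c(0) = 1`, `c'(0) = 0` and `s(0) = 0`, `s'(0) = 1`. -/
structure IsHillBasis (q : ℝ → ℝ) (E : ℝ) (c c' s s' : ℝ → ℝ) : Prop where
  c_sol : IsHillSolution q E c c'
  s_sol : IsHillSolution q E s s'
  c_zero : c 0 = 1
  c'_zero : c' 0 = 0
  s_zero : s 0 = 0
  s'_zero : s' 0 = 1

variable {q : ℝ → ℝ}

theorem IsHillSolution.continuous {E : ℝ} {y y' : ℝ → F} (h : IsHillSolution q E y y') :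
    Continuous y :=
  continuous_iff_continuousAt.2 fun t => (h.hasDerivAt t).continuousAt

theorem IsHillSolution.comp_add_const {E T : ℝ} (hq : Function.Periodic q T) {y y' : ℝ → F}
    (h : IsHillSolution q E y y') :
    IsHillSolution q E (fun t => y (t + T)) (fun t => y' (t + T)) where
  hasDerivAt t := (h.hasDerivAt (t + T)).comp_add_const t T
  hasDerivAt' t := by simpa [hq t] using (h.hasDerivAt' (t + T)).comp_add_const t T

theorem IsHillSolution.comp_neg {E : ℝ} (hq : ∀ t, q (-t) = q t) {y y' : ℝ → F}
    (h : IsHillSolution q E y y') :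
    IsHillSolution q E (fun t => y (-t)) (fun t => -y' (-t)) where
  hasDerivAt t := by
    simpa [Function.comp_def] using (h.hasDerivAt (-t)).scomp t (hasDerivAt_neg t)
  hasDerivAt' t := by
    simpa [hq t, Function.comp_def] using ((h.hasDerivAt' (-t)).scomp t (hasDerivAt_neg t)).fun_neg

theorem IsHillSolution.hasDerivAt_wronskian {E₁ E₂ : ℝ} {y y' : ℝ → ℝ} {z z' : ℝ → F}
    (hy : IsHillSolution q E₁ y y') (hz : IsHillSolution q E₂ z z') (t : ℝ) :
    HasDerivAt (fun t => y' t • z t - y t • z' t) ((E₁ - E₂) • y t • z t) t := by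
  refine (((hy.hasDerivAt' t).fun_smul (hz.hasDerivAt t)).fun_sub
    ((hy.hasDerivAt t).fun_smul (hz.hasDerivAt' t))).congr_deriv ?_
  simp only [smul_eq_mul]
  module

theorem IsHillSolution.wronskian_eq {E : ℝ} {y y' : ℝ → ℝ} {z z' : ℝ → F}
    (hy : IsHillSolution q E y y') (hz : IsHillSolution q E z z') (t : ℝ) :
    y' t • z t - y t • z' t = y' 0 • z 0 - y 0 • z' 0 := by
  refine is_const_of_deriv_eq_zero (f := fun t => y' t • z t - y t • z' t)
    (fun s => (hy.hasDerivAt_wronskian hz s).differentiableAt) (fun s => ?_) t 0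
  simpa using (hy.hasDerivAt_wronskian hz s).deriv

theorem IsHillSolution.wronskian_sub_eq_integral {E₁ E₂ : ℝ} {y y' z z' : ℝ → ℝ}
    (hy : IsHillSolution q E₁ y y') (hz : IsHillSolution q E₂ z z') (t : ℝ) :
    (y' t * z t - y t * z' t) - (y' 0 * z 0 - y 0 * z' 0)
      = (E₁ - E₂) * ∫ r in (0 : ℝ)..t, y r * z r := by
  rw [← intervalIntegral.integral_const_mul]
  refine (intervalIntegral.integral_eq_sub_of_hasDerivAt
    (f := fun t => y' t * z t - y t * z' t)
    (fun r _ => by simpa using hy.hasDerivAt_wronskian hz r) ?_).symm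
  exact (continuous_const.mul (hy.continuous.mul hz.continuous)).intervalIntegrable 0 t

namespace IsHillBasis

variable {E : ℝ} {c c' s s' : ℝ → ℝ}

theorem det_eq_one (h : IsHillBasis q E c c' s s') (t : ℝ) : c t * s' t - c' t * s t = 1 := by
  have := h.c_sol.wronskian_eq h.s_sol t
  simp only [h.c_zero, h.c'_zero, h.s'_zero, h.s_zero, smul_eq_mul] at this
  linarith

theorem eq_smul_add_smul (h : IsHillBasis q E c c' s s') {z z' : ℝ → F}
    (hz : IsHillSolution q E z z') (t : ℝ) :
    z t = c t • z 0 + s t • z' 0 ∧ z' t = c' t • z 0 + s' t • z' 0 := by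
  have h1 := h.c_sol.wronskian_eq hz t
  have h2 := h.s_sol.wronskian_eq hz t
  have hd := h.det_eq_one t
  simp only [h.c_zero, h.c'_zero, h.s'_zero, h.s_zero, zero_smul, one_smul, zero_sub,
    sub_zero] at h1 h2
  have h1' : z' 0 = c t • z' t - c' t • z t := by rw [← neg_neg (z' 0), ← h1]; abel
  constructor
  · rw [← h2, h1']
    calc z t = (c t * s' t - c' t * s t) • z t := by rw [hd, one_smul]
      _ = _ := by module
  · rw [← h2, h1']
    calc z' t = (c t * s' t - c' t * s t) • z' t := by rw [hd, one_smul]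
      _ = _ := by module

theorem even_odd (h : IsHillBasis q E c c' s s') (hq : ∀ t, q (-t) = q t) (t : ℝ) :
    c (-t) = c t ∧ c' (-t) = -c' t ∧ s (-t) = -s t ∧ s' (-t) = s' t := by
  obtain ⟨h1, h2⟩ := h.eq_smul_add_smul (h.c_sol.comp_neg hq) t
  obtain ⟨h3, h4⟩ := h.eq_smul_add_smul (h.s_sol.comp_neg hq) t
  simp only [neg_zero, h.c_zero, h.c'_zero, h.s_zero, h.s'_zero, smul_eq_mul] at h1 h2 h3 h4
  exact ⟨by linarith, by linarith, by linarith, by linarith⟩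

/-- For an even periodic potential the two diagonal entries of the monodromy matrix agree. -/
theorem diag_eq (h : IsHillBasis q E c c' s s') (hq : ∀ t, q (-t) = q t) {T : ℝ}
    (hT : Function.Periodic q T) : s' T = c T := by
  obtain ⟨h1, h2⟩ := h.eq_smul_add_smul (h.c_sol.comp_add_const hT) (-T)
  obtain ⟨-, h4⟩ := h.eq_smul_add_smul (h.s_sol.comp_add_const hT) (-T)
  obtain ⟨e1, e2, e3, e4⟩ := h.even_odd hq T
  simp only [neg_add_cancel, zero_add, h.c_zero, h.c'_zero, h.s'_zero, smul_eq_mul, e1,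
    e2, e3, e4] at h1 h2 h4
  have hd := h.det_eq_one T
  have k1 : c T * (c T - s' T) = 0 := by linarith
  have k2 : s' T * (c T - s' T) = 0 := by linarith
  have k3 : (c T - s' T) ^ 2 = 0 := by linear_combination k1 - k2
  have := pow_eq_zero_iff (two_ne_zero) |>.1 k3
  linarith

end IsHillBasis

/-- The equation `y'' + q y = B y` in a Banach space, with a bounded operator `B`. -/
theorem exists_hillSolution_operator {X : Type*} [NormedAddCommGroup X] [NormedSpace ℝ X]
    [CompleteSpace X] (hq : Continuous q) {M : ℝ} (hM : ∀ t, |q t| ≤ M) (B : X →L[ℝ] X)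
    (a b : X) :
    ∃ y y' : ℝ → X, y 0 = a ∧ y' 0 = b ∧ (∀ t, HasDerivAt y (y' t) t) ∧
      ∀ t, HasDerivAt y' (B (y t) - q t • y t) t := by
  let A₀ : (X × X) →L[ℝ] (X × X) := (ContinuousLinearMap.snd ℝ X X).prod
    (B.comp (ContinuousLinearMap.fst ℝ X X))
  let A₁ : (X × X) →L[ℝ] (X × X) :=
    (0 : (X × X) →L[ℝ] X).prod (ContinuousLinearMap.fst ℝ X X)
  have hA : Continuous fun t => A₀ - q t • A₁ := continuous_const.sub (hq.smul continuous_const)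
  have hAM : ∀ t, ‖A₀ - q t • A₁‖ ≤ ‖A₀‖ + M * ‖A₁‖ := fun t => by
    refine (norm_sub_le A₀ (q t • A₁)).trans ?_
    rw [norm_smul, Real.norm_eq_abs]
    gcongr
    exact hM t
  obtain ⟨Y, hY0, hY⟩ := exists_linear_ode_solution hA hAM (a, b)
  refine ⟨fun t => (Y t).1, fun t => (Y t).2, by simp [hY0], by simp [hY0], fun t => ?_,
    fun t => ?_⟩
  · simpa [A₀, A₁, Function.comp_def] using
      (ContinuousLinearMap.fst ℝ X X).hasFDerivAt.comp_hasDerivAt t (hY t)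
  · simpa [A₀, A₁, Function.comp_def] using
      (ContinuousLinearMap.snd ℝ X X).hasFDerivAt.comp_hasDerivAt t (hY t)

/-- Solutions of Hill's equation with prescribed initial values exist for all `E` in `[-1, 1]` and
depend continuously on `(E, t)`. The equation is solved at once for all these `E`, as an
equation in the Banach algebra `C([-1, 1])`, where multiplication by `E` is a bounded operator. -/
theorem exists_hillSolution_family (hq : Continuous q) {M : ℝ} (hM : ∀ t, |q t| ≤ M) (a b : ℝ) :
    ∃ y y' : ℝ → ℝ → ℝ, (∀ E ∈ Set.Icc (-1 : ℝ) 1, IsHillSolution q E (y E) (y' E)) ∧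
      (∀ E, y E 0 = a) ∧ (∀ E, y' E 0 = b) ∧ Continuous (Function.uncurry y) := by
  obtain ⟨y, y', hy0, hy0', hy, hy'⟩ := exists_hillSolution_operator hq hM
    (ContinuousLinearMap.mul ℝ C(Set.Icc (-1 : ℝ) 1, ℝ) ⟨Subtype.val, continuous_subtype_val⟩)
    (ContinuousMap.const _ a) (ContinuousMap.const _ b)
  have hyc : Continuous y := continuous_iff_continuousAt.2 fun t => (hy t).continuousAt
  let π := Set.projIcc (-1 : ℝ) 1 (by norm_num)
  refine ⟨fun E t => y t (π E), fun E t => y' t (π E), fun E hE => ⟨fun t => ?_, fun t => ?_⟩,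
    fun E => by simp [hy0], fun E => by simp [hy0'], ?_⟩
  · exact (ContinuousMap.evalCLM ℝ (π E)).hasFDerivAt.comp_hasDerivAt t (hy t)
  · have hπ : (π E : ℝ) = E := by simp [π, Set.projIcc_of_mem _ hE]
    refine ((ContinuousMap.evalCLM ℝ (π E)).hasFDerivAt.comp_hasDerivAt t (hy' t)).congr_deriv ?_
    change (π E : ℝ) * y t (π E) - q t * y t (π E) = (E - q t) * y t (π E)
    rw [hπ]
    ring
  · have h1 : Continuous fun p : ℝ × ℝ => y p.2 := hyc.comp continuous_snd
    have h2 : Continuous fun p : ℝ × ℝ => π p.1 := continuous_projIcc.comp continuous_fst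
    exact h1.eval h2

end Hill

/-! ### Dependence of the discriminant on the spectral parameter -/

/-- Carathéodory's criterion, in the direction that produces a derivative. -/
theorem hasDerivAt_of_sub_eq_mul {f g : ℝ → ℝ} {a : ℝ} (hg : ContinuousAt g a)
    (h : ∀ᶠ x in 𝓝 a, f x - f a = (x - a) * g x) : HasDerivAt f (g a) a := by
  rw [hasDerivAt_iff_tendsto_slope]
  refine (hg.tendsto.mono_left nhdsWithin_le_nhds).congr' ?_
  filter_upwards [h.filter_mono nhdsWithin_le_nhds, self_mem_nhdsWithin] with x hx hxa
  have : x - a ≠ 0 := sub_ne_zero.2 hxa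
  rw [slope_def_field, hx]
  field_simp

/-- The half discriminant `E ↦ c_E(T)` is continuously differentiable. Comparing two values of `E`
by Wronskians expresses its difference quotient by integrals that depend continuously on `E`. -/
theorem hasDerivAt_halfDiscriminant {q : ℝ → ℝ} {c c' s s' : ℝ → ℝ → ℝ}
    (h : ∀ E ∈ Set.Icc (-1 : ℝ) 1, IsHillBasis q E (c E) (c' E) (s E) (s' E))
    (hc : Continuous (Function.uncurry c)) (T : ℝ) {E : ℝ}
    (hE : E ∈ Set.Ioo (-1 : ℝ) 1) :
    HasDerivAt (fun E => c E T)
      (s E T * (∫ t in (0 : ℝ)..T, c E t * c E t) - c E T * ∫ t in (0 : ℝ)..T, c E t * s E t) E := by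
  have hE' := Set.Ioo_subset_Icc_self hE
  have hb := h E hE'
  have hcont : ∀ g : ℝ → ℝ, Continuous g →
      Continuous fun e => ∫ t in (0 : ℝ)..T, c e t * g t := fun g hg =>
    intervalIntegral.continuous_parametric_intervalIntegral_of_continuous'
      (hc.mul (hg.comp continuous_snd)) 0 T
  refine hasDerivAt_of_sub_eq_mul (g := fun e => s E T * (∫ t in (0 : ℝ)..T, c e t * c E t)
    - c E T * ∫ t in (0 : ℝ)..T, c e t * s E t) ?_ ?_
  · exact ((continuous_const.mul (hcont _ hb.c_sol.continuous)).sub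
      (continuous_const.mul (hcont _ hb.s_sol.continuous))).continuousAt
  · filter_upwards [Icc_mem_nhds hE.1 hE.2] with e he
    have hbe := h e he
    have h1 := hbe.c_sol.wronskian_sub_eq_integral hb.s_sol T
    have h2 := hbe.c_sol.wronskian_sub_eq_integral hb.c_sol T
    have hd := hb.det_eq_one T
    simp only [hbe.c_zero, hbe.c'_zero, hb.c_zero, hb.c'_zero, hb.s_zero, hb.s'_zero] at h1 h2
    linear_combination (-c E T) * h1 + s E T * h2 - c e T * hd

theorem continuous_deriv_halfDiscriminant {c s : ℝ → ℝ → ℝ}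
    (hc : Continuous (Function.uncurry c)) (hs : Continuous (Function.uncurry s)) (T : ℝ) :
    Continuous fun E => s E T * (∫ t in (0 : ℝ)..T, c E t * c E t)
      - c E T * ∫ t in (0 : ℝ)..T, c E t * s E t := by
  have h1 : Continuous fun E => ∫ t in (0 : ℝ)..T, c E t * c E t :=
    intervalIntegral.continuous_parametric_intervalIntegral_of_continuous' (hc.mul hc) 0 T
  have h2 : Continuous fun E => ∫ t in (0 : ℝ)..T, c E t * s E t :=
    intervalIntegral.continuous_parametric_intervalIntegral_of_continuous' (hc.mul hs) 0 T
  have h3 : Continuous fun E => c E T := hc.comp (continuous_id.prodMk continuous_const)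
  have h4 : Continuous fun E => s E T := hs.comp (continuous_id.prodMk continuous_const)
  exact (h4.mul h1).sub (h3.mul h2)

/-! ### The band set and the discriminant -/

section Band

variable {V u : ℝ → ℝ} {E : ℝ}

theorem isHillSolution_of_mem_newtonSpace {ξ : ℝ → ℂ} (hξ : ξ ∈ newtonSpace V u E) :
    IsHillSolution (fun t => deriv (deriv V) (u t)) E ξ (deriv ξ) where
  hasDerivAt t := (hξ.1.differentiable (by norm_num) t).hasDerivAt
  hasDerivAt' t := by
    refine (hξ.1.differentiable_deriv_two t).hasDerivAt.congr_deriv ?_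
    have h := hξ.2 t
    simp only [newtonOperator] at h
    rw [Complex.real_smul]
    push_cast
    linear_combination h

theorem IsHillSolution.mem_newtonSpace (hq : Continuous fun t => deriv (deriv V) (u t))
    {ξ ξ' : ℝ → ℂ} (h : IsHillSolution (fun t => deriv (deriv V) (u t)) E ξ ξ') :
    ξ ∈ newtonSpace V u E := by
  have h1 : deriv ξ = ξ' := funext fun t => (h.hasDerivAt t).deriv
  have h2 : deriv ξ' = fun t => (E - deriv (deriv V) (u t)) • ξ t :=
    funext fun t => (h.hasDerivAt' t).deriv
  refine ⟨?_, fun t => ?_⟩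
  · rw [show (2 : WithTop ℕ∞) = 1 + 1 by norm_num, contDiff_succ_iff_deriv]
    refine ⟨fun t => (h.hasDerivAt t).differentiableAt, by simp, ?_⟩
    rw [h1, contDiff_one_iff_deriv, h2]
    exact ⟨fun t => (h.hasDerivAt' t).differentiableAt,
      (continuous_const.sub hq).smul h.continuous⟩
  · simp only [newtonOperator, h1, h2]
    rw [Complex.real_smul]
    push_cast
    ring

/-- A real `2 × 2` matrix of determinant one with equal diagonal entries `x` has the
eigenvalue `exp (iθ)` exactly when `x = cos θ`. -/
theorem exists_eigenvector_iff {x y z : ℝ} (hdet : x * x - z * y = 1) (θ : ℝ) :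
    (∃ a b : ℂ, (a ≠ 0 ∨ b ≠ 0) ∧ x * a + y * b = Complex.exp (Complex.I * θ) * a ∧
      z * a + x * b = Complex.exp (Complex.I * θ) * b) ↔ x = Real.cos θ := by
  set l := Complex.exp (Complex.I * θ) with hl
  have hl0 : l ≠ 0 := Complex.exp_ne_zero _
  have hdet' : (x : ℂ) * x - z * y = 1 := by exact_mod_cast hdet
  have hcos : (2 * Real.cos θ : ℂ) * l = l ^ 2 + 1 := by
    rw [Complex.ofReal_cos, Complex.two_cos, mul_comm (θ : ℂ), neg_mul, mul_comm (θ : ℂ), ← hl,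
      Complex.exp_neg, ← hl]
    field_simp
  constructor
  · rintro ⟨a, b, hab, h1, h2⟩
    have hchar : l ^ 2 - 2 * x * l + 1 = 0 := by
      have ha : (l ^ 2 - 2 * x * l + 1) * a = 0 := by
        linear_combination (x - l) * h1 - y * h2 - a * hdet'
      have hb : (l ^ 2 - 2 * x * l + 1) * b = 0 := by
        linear_combination (x - l) * h2 - z * h1 - b * hdet'
      rcases hab with h | h
      · exact (mul_eq_zero.1 ha).resolve_right h
      · exact (mul_eq_zero.1 hb).resolve_right h
    have h3 : (x : ℂ) = Real.cos θ :=
      mul_right_cancel₀ hl0 (by linear_combination (-1 / 2 : ℂ) * hchar - (1 / 2 : ℂ) * hcos)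
    exact_mod_cast h3
  · intro hx
    rw [← hx] at hcos
    by_cases hy : y = 0
    · by_cases hz : z = 0
      · refine ⟨1, 0, Or.inl one_ne_zero, ?_, by simp [hz]⟩
        have hsq : ((x : ℂ) - l) ^ 2 = 0 := by
          rw [hy, hz] at hdet'
          push_cast at hdet'
          linear_combination hdet' - hcos
        have := pow_eq_zero_iff two_ne_zero |>.1 hsq
        linear_combination this
      · exact ⟨l - x, z, Or.inr (by exact_mod_cast hz),
          by linear_combination hcos - hdet', by ring⟩
    · exact ⟨y, l - x, Or.inl (by exact_mod_cast hy), by ring,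
        by linear_combination hcos - hdet'⟩

theorem mem_bandSet_iff {T : ℝ} (hu : Function.Periodic u T) (hev : ∀ t, u (-t) = u t)
    (hq : Continuous fun t => deriv (deriv V) (u t)) {c c' s s' : ℝ → ℝ}
    (h : IsHillBasis (fun t => deriv (deriv V) (u t)) E c c' s s') (θ : ℝ) :
    (θ, E) ∈ bandSet V u T hu ↔ c T = Real.cos θ := by
  have hqT : Function.Periodic (fun t => deriv (deriv V) (u t)) T := fun t => by simp [hu t]
  have hs' : s' T = c T := h.diag_eq (fun t => by simp [hev t]) hqT
  have hdet := h.det_eq_one T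
  rw [hs'] at hdet
  rw [← exists_eigenvector_iff hdet θ]
  simp only [bandSet, Set.mem_ofPred_eq]
  constructor
  · intro hev
    obtain ⟨ξ, hξ⟩ := hev.exists_hasEigenvector
    have hsol := isHillSolution_of_mem_newtonSpace ξ.2
    have hT : ∀ t, (ξ : ℝ → ℂ) (t + T) = Complex.exp (Complex.I * θ) * (ξ : ℝ → ℂ) t := fun t =>
      congrFun (congrArg Subtype.val hξ.apply_eq_smul) t
    have hT' : deriv (ξ : ℝ → ℂ) (0 + T) = Complex.exp (Complex.I * θ) * deriv (ξ : ℝ → ℂ) 0 := by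
      have h1 := (hsol.hasDerivAt (0 + T)).comp_add_const 0 T
      have h2 := (hsol.hasDerivAt 0).const_mul (Complex.exp (Complex.I * θ))
      simp only [hT] at h1
      exact h1.unique h2
    obtain ⟨e1, e2⟩ := h.eq_smul_add_smul hsol T
    rw [zero_add] at hT'
    have hT0 := hT 0
    rw [zero_add] at hT0
    simp only [Complex.real_smul] at e1 e2
    refine ⟨(ξ : ℝ → ℂ) 0, deriv (ξ : ℝ → ℂ) 0, ?_, by rw [← hT0, e1], by rw [← hT', e2, hs']⟩
    by_contra! hab
    refine hξ.2 (Subtype.ext (funext fun t => ?_))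
    simpa [hab.1, hab.2] using (h.eq_smul_add_smul hsol t).1
  · rintro ⟨a, b, hab, h1, h2⟩
    let ξ : ℝ → ℂ := fun t => c t • a + s t • b
    let ξ' : ℝ → ℂ := fun t => c' t • a + s' t • b
    have hsol : IsHillSolution (fun t => deriv (deriv V) (u t)) E ξ ξ' :=
      { hasDerivAt := fun t => ((h.c_sol.hasDerivAt t).smul_const a).add
          ((h.s_sol.hasDerivAt t).smul_const b)
        hasDerivAt' := fun t => (((h.c_sol.hasDerivAt' t).smul_const a).add
          ((h.s_sol.hasDerivAt' t).smul_const b)).congr_deriv (by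
            simp only [ξ, smul_eq_mul]; module) }
    have hξ0 : ξ 0 = a := by simp [ξ, h.c_zero, h.s_zero]
    have hξ0' : ξ' 0 = b := by simp [ξ', h.c'_zero, h.s'_zero]
    have htrans : ∀ t, ξ (t + T) = Complex.exp (Complex.I * θ) * ξ t := fun t => by
      have e := (h.eq_smul_add_smul (hsol.comp_add_const hqT) t).1
      have eT : ξ (0 + T) = Complex.exp (Complex.I * θ) * a := by
        rw [← h1]; simp [ξ]
      have eT' : ξ' (0 + T) = Complex.exp (Complex.I * θ) * b := by
        rw [← h2]; simp [ξ', hs']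
      rw [e, eT, eT']
      simp only [ξ, Complex.real_smul]
      ring
    refine Module.End.hasEigenvalue_of_hasEigenvector
      (x := (⟨ξ, hsol.mem_newtonSpace hq⟩ : newtonSpace V u E)) ⟨?_, fun h0 => ?_⟩
    · rw [Module.End.mem_eigenspace_iff]
      exact Subtype.ext (funext htrans)
    · have hz : ξ = 0 := congrArg Subtype.val h0
      have hz' : ξ' = 0 := by
        funext t
        have := (hsol.hasDerivAt t).deriv
        rw [hz] at this
        rw [← this]
        exact deriv_const t 0
      rcases hab with hab | hab
      · exact hab (by rw [← hξ0, hz]; rfl)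
      · exact hab (by rw [← hξ0', hz']; rfl)

end Band

/-! ### Newton's equation near a bounded orbit -/

/-- `x` solves Newton's equation `x'' + V'(x) = 0`, and `y` is its velocity. -/
structure IsNewtonSolution (V : ℝ → ℝ) (x y : ℝ → ℝ) : Prop where
  hasDerivAt : ∀ t, HasDerivAt x (y t) t
  hasDerivAt' : ∀ t, HasDerivAt y (-deriv V (x t)) t

section Newton

variable {V : ℝ → ℝ}

theorem continuous_deriv_deriv (hV : ContDiff ℝ 2 V) : Continuous (deriv (deriv V)) := by
  have h : ContDiff ℝ 1 (deriv V) := (contDiff_succ_iff_deriv (n := 1)).1 hV |>.2.2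
  exact (contDiff_one_iff_deriv.1 h).2

theorem hasDerivAt_deriv (hV : ContDiff ℝ 2 V) (p : ℝ) :
    HasDerivAt (deriv V) (deriv (deriv V) p) p :=
  (hV.differentiable_deriv_two p).hasDerivAt

theorem IsNewtonSolution.continuous {x y : ℝ → ℝ} (h : IsNewtonSolution V x y) : Continuous x :=
  continuous_iff_continuousAt.2 fun t => (h.hasDerivAt t).continuousAt

theorem IsNewtonSolution.continuous' {x y : ℝ → ℝ} (h : IsNewtonSolution V x y) : Continuous y :=
  continuous_iff_continuousAt.2 fun t => (h.hasDerivAt' t).continuousAt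

/-- Solutions of Newton's equation that start with the same velocity as a bounded solution and
close to it stay, on a compact time interval, at a distance proportional to the initial one. -/
theorem IsNewtonSolution.exists_dist_le (hV : ContDiff ℝ 2 V) {u v : ℝ → ℝ}
    (hu : IsNewtonSolution V u v) {R : ℝ} (hR : ∀ t, |u t| ≤ R) (S : ℝ) :
    ∃ C > 0, ∃ δ > 0, ∀ x y : ℝ → ℝ, IsNewtonSolution V x y → y 0 = v 0 → |x 0 - u 0| < δ →
      ∀ t ∈ Set.Icc 0 S, |x t - u t| ≤ C * |x 0 - u 0| := by
  obtain ⟨K₀, hK₀⟩ := (isCompact_Icc (a := -(R + 1)) (b := R + 1)).exists_bound_of_continuousOn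
    (continuous_deriv_deriv hV).continuousOn
  set K := max K₀ 1
  have hK1 : 1 ≤ K := le_max_right _ _
  have hlip : ∀ p ∈ Set.Icc (-(R + 1)) (R + 1), ∀ p' ∈ Set.Icc (-(R + 1)) (R + 1),
      |deriv V p' - deriv V p| ≤ K * |p' - p| := fun p hp p' hp' =>
    (convex_Icc _ _).norm_image_sub_le_of_norm_hasDerivWithin_le
      (fun z _ => (hasDerivAt_deriv hV z).hasDerivWithinAt)
      (fun z hz => (hK₀ z hz).trans (le_max_left _ _)) hp hp'
  refine ⟨Real.exp (K * S), Real.exp_pos _, (Real.exp (K * S))⁻¹, by positivity,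
    fun x y hx hxy hδ => ?_⟩
  -- Grönwall's inequality applies for as long as the distance is at most one.
  have key : ∀ b ≤ S, (∀ t ∈ Set.Ico 0 b, |x t - u t| ≤ 1) →
      ∀ t ∈ Set.Icc 0 b, |x t - u t| ≤ Real.exp (K * S) * |x 0 - u 0| := by
    intro b hb hclose t ht
    have hd : ∀ t, HasDerivAt (fun t => (x t - u t, y t - v t))
        (y t - v t, -deriv V (x t) - -deriv V (u t)) t := fun t =>
      ((hx.hasDerivAt t).sub (hu.hasDerivAt t)).prodMk
        ((hx.hasDerivAt' t).sub (hu.hasDerivAt' t))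
    have hg := norm_le_gronwallBound_of_norm_deriv_right_le (δ := |x 0 - u 0|) (K := K) (ε := 0)
      (a := 0) (b := b) (fun t _ => (hd t).continuousAt.continuousWithinAt)
      (fun t _ => (hd t).hasDerivWithinAt) (by simp [hxy, Prod.norm_def]) (fun t ht => ?_) t ht
    · rw [gronwallBound_ε0, sub_zero] at hg
      have h1 : |x t - u t| ≤ |x 0 - u 0| * Real.exp (K * t) := (norm_fst_le _).trans hg
      have h2 : Real.exp (K * t) ≤ Real.exp (K * S) :=
        Real.exp_le_exp.2 (mul_le_mul_of_nonneg_left (ht.2.trans hb) (by linarith))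
      nlinarith [abs_nonneg (x 0 - u 0)]
    · have hu' := abs_le.1 (hR t)
      have hxt := abs_le.1 (hclose t ht)
      have h1 := hlip (u t) ⟨by linarith, by linarith⟩ (x t) ⟨by linarith, by linarith⟩
      have h2 : |x t - u t| ≤ ‖(x t - u t, y t - v t)‖ := norm_fst_le (x t - u t, y t - v t)
      have h3 : |y t - v t| ≤ ‖(x t - u t, y t - v t)‖ := norm_snd_le (x t - u t, y t - v t)
      rw [add_zero]
      refine max_le (h3.trans ?_) ?_
      · exact le_mul_of_one_le_left (norm_nonneg _) hK1
      · have h4 : ‖-deriv V (x t) - -deriv V (u t)‖ = |deriv V (x t) - deriv V (u t)| := by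
          rw [Real.norm_eq_abs, neg_sub_neg, abs_sub_comm]
        exact h4.le.trans (h1.trans (mul_le_mul_of_nonneg_left h2 (by linarith)))
  -- The first time at which the distance reaches one would contradict the bound just obtained.
  by_contra! hcon
  obtain ⟨t₁, ht₁, hlt⟩ := hcon
  have hex : ∃ t ∈ Set.Ico 0 t₁, 1 < |x t - u t| := by
    by_contra! h
    exact absurd (key t₁ ht₁.2 h t₁ ⟨ht₁.1, le_rfl⟩) (not_le.2 hlt)
  obtain ⟨t₂, ht₂, hgt⟩ := hex
  have hcomp : IsCompact (Set.Icc 0 t₂ ∩ {t | 1 ≤ |x t - u t|}) :=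
    isCompact_Icc.inter_right
      (isClosed_le continuous_const (hx.continuous.sub hu.continuous).abs)
  obtain ⟨b, ⟨hb, hb1⟩, hmin⟩ := hcomp.exists_isLeast ⟨t₂, ⟨ht₂.1, le_rfl⟩, hgt.le⟩
  have h1 := key b (hb.2.trans (ht₂.2.le.trans ht₁.2)) (fun t ht => by
    by_contra! h
    exact absurd (hmin ⟨⟨ht.1, ht.2.le.trans hb.2⟩, h.le⟩) (not_le.2 ht.2)) b ⟨hb.1, le_rfl⟩
  have h2 : Real.exp (K * S) * |x 0 - u 0| < 1 := by
    rwa [← lt_inv_mul_iff₀ (Real.exp_pos _), mul_one]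
  have h3 : 1 ≤ |x b - u b| := hb1
  linarith

/-- First-order Taylor expansion of the force, uniformly on compact sets. -/
theorem exists_abs_taylor_force_le (hV : ContDiff ℝ 2 V) (R : ℝ) {ε : ℝ} (hε : 0 < ε) :
    ∃ η > 0, ∀ p p' : ℝ, |p| ≤ R → |p' - p| ≤ η →
      |deriv V p' - deriv V p - deriv (deriv V) p * (p' - p)| ≤ ε * |p' - p| := by
  have huc := (isCompact_Icc (a := -(R + 1)) (b := R + 1)).uniformContinuousOn_of_continuous
    (continuous_deriv_deriv hV).continuousOn
  obtain ⟨η, hη, huc⟩ := Metric.uniformContinuousOn_iff.1 huc ε hε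
  refine ⟨min (η / 2) 1, by positivity, fun p p' hp hpp => ?_⟩
  have hp1 := abs_le.1 hp
  have hη' : |p' - p| ≤ η / 2 := hpp.trans (min_le_left _ _)
  have h1 : |p' - p| ≤ 1 := hpp.trans (min_le_right _ _)
  have hd : ∀ z, HasDerivAt (fun z => deriv V z - deriv (deriv V) p * z)
      (deriv (deriv V) z - deriv (deriv V) p) z := fun z => by
    simpa using (hasDerivAt_deriv hV z).fun_sub ((hasDerivAt_id z).const_mul (deriv (deriv V) p))
  have := (convex_uIcc p p').norm_image_sub_le_of_norm_hasDerivWithin_le (C := ε)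
    (fun z _ => (hd z).hasDerivWithinAt) (fun z hz => ?_) Set.left_mem_uIcc Set.right_mem_uIcc
  · calc _ = ‖(deriv V p' - deriv (deriv V) p * p') - (deriv V p - deriv (deriv V) p * p)‖ := by
          rw [Real.norm_eq_abs]; congr 1; ring
      _ ≤ _ := this
  · have hz' : |z - p| ≤ |p' - p| := Set.abs_sub_left_of_mem_uIcc hz
    have hz1 := abs_le.1 (hz'.trans h1)
    refine (huc z ⟨by linarith, by linarith⟩ p ⟨by linarith, by linarith⟩ ?_).le
    rw [Real.dist_eq]
    linarith

/-- The linearisation of Newton's equation is Hill's equation: the Wronskian of a Hill solution with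
the difference of two nearby orbits is of higher order in the initial distance, uniformly on
compact time intervals. -/
theorem IsNewtonSolution.exists_wronskian_le (hV : ContDiff ℝ 2 V) {u v : ℝ → ℝ}
    (hu : IsNewtonSolution V u v) {R : ℝ} (hR : ∀ t, |u t| ≤ R) {c c' : ℝ → ℝ}
    (hc : IsHillSolution (fun t => deriv (deriv V) (u t)) 0 c c') (hc0 : c' 0 = 0)
    (S : ℝ) {ε : ℝ} (hε : 0 < ε) :
    ∃ δ > 0, ∀ x y : ℝ → ℝ, IsNewtonSolution V x y → y 0 = v 0 → |x 0 - u 0| < δ →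
      ∀ t ∈ Set.Icc 0 S, |c' t * (x t - u t) - c t * (y t - v t)| ≤ ε * |x 0 - u 0| := by
  obtain ⟨C, hC, δ, hδ, hdist⟩ := hu.exists_dist_le hV hR S
  obtain ⟨B₀, hB₀⟩ := (isCompact_Icc (a := 0) (b := S)).exists_bound_of_continuousOn
    hc.continuous.continuousOn
  set B := max B₀ 1
  have hB : 0 < B := lt_of_lt_of_le one_pos (le_max_right _ _)
  have hSp : 0 < |S| + 1 := by positivity
  obtain ⟨η, hη, hforce⟩ := exists_abs_taylor_force_le hV R (ε := ε / (B * C * (|S| + 1)))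
    (by positivity)
  refine ⟨min δ (η / C), by positivity, fun x y hx hxy hlt t ht => ?_⟩
  have hclose := hdist x y hx hxy (hlt.trans_le (min_le_left _ _))
  have hlt' : C * |x 0 - u 0| ≤ η := by
    have := (hlt.trans_le (min_le_right _ _)).le
    rwa [le_div_iff₀ hC, mul_comm] at this
  have hd : ∀ t, HasDerivAt (fun t => c' t * (x t - u t) - c t * (y t - v t))
      (c t * (deriv V (x t) - deriv V (u t) - deriv (deriv V) (u t) * (x t - u t))) t := fun t => by
    refine (((hc.hasDerivAt' t).fun_mul ((hx.hasDerivAt t).sub (hu.hasDerivAt t))).fun_sub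
      ((hc.hasDerivAt t).fun_mul ((hx.hasDerivAt' t).sub (hu.hasDerivAt' t)))).congr_deriv ?_
    simp only [smul_eq_mul, Pi.sub_apply]
    ring
  have hb : ∀ r ∈ Set.Ico 0 S,
      ‖c r * (deriv V (x r) - deriv V (u r) - deriv (deriv V) (u r) * (x r - u r))‖
        ≤ ε / (|S| + 1) * |x 0 - u 0| := fun r hr => by
    have hr' := Set.Ico_subset_Icc_self hr
    have h1 := hclose r hr'
    have h2 := hforce (u r) (x r) (hR r) (h1.trans hlt')
    have h3 : |c r| ≤ B := (hB₀ r hr').trans (le_max_left _ _)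
    rw [Real.norm_eq_abs, abs_mul]
    calc _ ≤ B * (ε / (B * C * (|S| + 1)) * (C * |x 0 - u 0|)) :=
          mul_le_mul h3 (h2.trans (mul_le_mul_of_nonneg_left h1 (by positivity)))
            (abs_nonneg _) hB.le
      _ = _ := by field_simp
  have hmv := norm_image_sub_le_of_norm_deriv_le_segment'
    (fun r _ => (hd r).hasDerivWithinAt) hb t ht
  simp only [hc0, hxy, sub_self, mul_zero, zero_mul, sub_zero, Real.norm_eq_abs] at hmv
  refine hmv.trans ?_
  have hS : t ≤ |S| + 1 := ht.2.trans ((le_abs_self S).trans (by linarith))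
  calc ε / (|S| + 1) * |x 0 - u 0| * t ≤ ε / (|S| + 1) * |x 0 - u 0| * (|S| + 1) := by gcongr
    _ = ε * |x 0 - u 0| := by field_simp

end Newton

/-! ### The band function near a tangency -/

/-- If near `(0, 0)` the set `B` is given by `D(E) = cos θ`, where `D` is continuously
differentiable with `D(0) = 1` and `D'(0) ≠ 0`, then it is there the graph of
`E(θ) = D⁻¹(cos θ)`. -/
theorem exists_band_function {D D' : ℝ → ℝ} {B : Set (ℝ × ℝ)}
    (hD : ∀ E ∈ Set.Ioo (-1 : ℝ) 1, HasDerivAt D (D' E) E) (hD'c : Continuous D') (hD0 : D 0 = 1)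
    (hκ : D' 0 ≠ 0) (hB : ∀ θ, ∀ E ∈ Set.Ioo (-1 : ℝ) 1, (θ, E) ∈ B ↔ D E = Real.cos θ) :
    ∃ E : ℝ → ℝ,
      (∀ᶠ p : ℝ × ℝ in 𝓝 (0, 0), p ∈ B ↔ p.2 = E p.1) ∧
      E 0 = 0 ∧ (∀ θ, E (-θ) = E θ) ∧
      (∀ᶠ θ in 𝓝 (0 : ℝ), DifferentiableAt ℝ E θ) ∧
      deriv E 0 = 0 ∧
      HasDerivAt (deriv E) (-(D' 0)⁻¹) 0 ∧
      (0 < D' 0 → ∀ᶠ θ in 𝓝[≠] (0 : ℝ), E θ < 0) ∧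
      (D' 0 < 0 → ∀ᶠ θ in 𝓝[≠] (0 : ℝ), 0 < E θ) := by
  have hI : ∀ᶠ E in 𝓝 (0 : ℝ), E ∈ Set.Ioo (-1 : ℝ) 1 := Ioo_mem_nhds (by norm_num) (by norm_num)
  have hs : HasStrictDerivAt D (D' 0) 0 :=
    hasStrictDerivAt_of_hasDerivAt_of_continuousAt (hI.mono hD) hD'c.continuousAt
  set g := hs.localInverse D (D' 0) 0 hκ with hg
  have hleft : ∀ᶠ E in 𝓝 (0 : ℝ), g (D E) = E := hs.eventually_left_inverse hκ
  have hright : ∀ᶠ y in 𝓝 (1 : ℝ), D (g y) = y := hD0 ▸ hs.eventually_right_inverse hκ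
  have hgs : HasStrictDerivAt g (D' 0)⁻¹ 1 := hD0 ▸ hs.to_localInverse hκ
  have hg1 : g 1 = 0 := hD0 ▸ hleft.self_of_nhds
  have hgt : Tendsto g (𝓝 1) (𝓝 0) := hg1 ▸ hgs.hasDerivAt.continuousAt.tendsto
  have hcos : Tendsto Real.cos (𝓝 0) (𝓝 1) := Real.cos_zero ▸ Real.continuous_cos.continuousAt
  -- By continuity of `D'`, the local inverse is differentiable near `1`, not only at `1`.
  have hgd : ∀ᶠ y in 𝓝 (1 : ℝ), HasDerivAt g (D' (g y))⁻¹ y := by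
    obtain ⟨K, N, hN, hlip⟩ := hgs.hasStrictFDerivAt.exists_lipschitzOnWith
    have hne : ∀ᶠ E in 𝓝 (0 : ℝ), D' E ≠ 0 := hD'c.continuousAt.eventually_ne hκ
    filter_upwards [eventually_mem_nhds_iff.2 hN, hright.eventually_nhds, hgt.eventually hne,
      hgt.eventually hI] with y hy1 hy2 hy3 hy4
    exact (hD _ hy4).of_local_left_inverse (hlip.continuousOn.continuousAt hy1) hy3 hy2
  have hEd : ∀ᶠ θ in 𝓝 (0 : ℝ),
      HasDerivAt (fun θ => g (Real.cos θ)) ((D' (g (Real.cos θ)))⁻¹ * -Real.sin θ) θ := by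
    filter_upwards [hcos.eventually hgd] with θ hθ
    exact hθ.comp θ (Real.hasDerivAt_cos θ)
  have hE0 : deriv (fun θ => g (Real.cos θ)) 0 = 0 := by
    simpa using hEd.self_of_nhds.deriv
  have hsign : ∀ᶠ θ in 𝓝[≠] (0 : ℝ), Real.cos θ < 1 := by
    have h1 : ∀ᶠ θ in 𝓝[≠] (0 : ℝ), |θ| < 1 :=
      nhdsWithin_le_nhds ((continuous_abs.tendsto' (0 : ℝ) 0 abs_zero).eventually_lt_const one_pos)
    filter_upwards [h1, self_mem_nhdsWithin] with θ hθ hθ0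
    have := Real.cos_lt_one_div_sqrt_sq_add_one (x := θ) (by linarith [(abs_lt.1 hθ).1,
      Real.pi_gt_three]) (by linarith [(abs_lt.1 hθ).2, Real.pi_gt_three]) hθ0
    refine this.trans ((div_lt_one (by positivity)).2 (Real.lt_sqrt_of_sq_lt ?_))
    have : 0 < θ ^ 2 := pow_two_pos_of_ne_zero hθ0
    linarith
  have hcos' : Tendsto Real.cos (𝓝[≠] 0) (𝓝[<] 1) :=
    tendsto_nhdsWithin_iff.2 ⟨hcos.mono_left nhdsWithin_le_nhds, hsign⟩
  have hslope : Tendsto (slope g 1) (𝓝[<] 1) (𝓝 (D' 0)⁻¹) :=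
    (hasDerivAt_iff_tendsto_slope.1 hgs.hasDerivAt).mono_left
      (nhdsWithin_mono _ fun y hy => ne_of_lt hy)
  have hslope_eq : ∀ y, (y - 1) * slope g 1 y = g y := fun y => by
    have := sub_smul_slope g 1 y
    simpa [hg1] using this
  refine ⟨fun θ => g (Real.cos θ), ?_, by simp [hg1], fun θ => by simp,
    hEd.mono fun θ h => h.differentiableAt, hE0, ?_, fun hpos => ?_, fun hneg => ?_⟩
  · have h1 : ∀ᶠ p : ℝ × ℝ in 𝓝 (0, 0), p.2 ∈ Set.Ioo (-1 : ℝ) 1 ∧ g (D p.2) = p.2 :=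
      (continuous_snd.tendsto ((0 : ℝ), (0 : ℝ))).eventually (hI.and hleft)
    have h2 : ∀ᶠ p : ℝ × ℝ in 𝓝 (0, 0), D (g (Real.cos p.1)) = Real.cos p.1 :=
      (hcos.comp (continuous_fst.tendsto ((0 : ℝ), (0 : ℝ)))).eventually hright
    filter_upwards [h1, h2] with p hp hp2
    rw [show p = (p.1, p.2) from rfl, hB p.1 p.2 hp.1]
    constructor
    · intro h
      rw [← h, hp.2]
    · intro h
      rw [h]
      exact hp2
  -- `D'` is only continuous, so the product rule is unavailable: the factor `θ` of `sin θ` is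
  -- split off instead.
  · have hφ : ContinuousAt (fun θ => (D' (g (Real.cos θ)))⁻¹ * -dslope Real.sin 0 θ) 0 := by
      refine ContinuousAt.mul (ContinuousAt.inv₀ ?_ (by simpa [hg1] using hκ)) ?_
      · refine hD'c.continuousAt.comp ?_
        have : Tendsto (fun θ => g (Real.cos θ)) (𝓝 0) (𝓝 (g (Real.cos 0))) := by
          simpa [hg1, Function.comp_def] using hgt.comp hcos
        exact this
      · exact (continuousAt_dslope_same.2 Real.differentiableAt_sin).neg
    have hder := hasDerivAt_of_sub_eq_mul (f := deriv fun θ => g (Real.cos θ)) hφ ?_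
    · simpa [hg1] using hder
    · filter_upwards [hEd] with θ hθ
      have hsin := sub_smul_dslope Real.sin 0 θ
      rw [Real.sin_zero, sub_zero, sub_zero, smul_eq_mul] at hsin
      rw [hθ.deriv, hE0, ← hsin]
      ring
  · filter_upwards [hcos'.eventually (hslope.eventually_const_lt (inv_pos.2 hpos)), hsign]
      with θ h1 h2
    rw [← hslope_eq]
    exact mul_neg_of_neg_of_pos (by linarith) h1
  · filter_upwards [hcos'.eventually (hslope.eventually_lt_const (inv_lt_zero.2 hneg)), hsign]
      with θ h1 h2
    rw [← hslope_eq]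
    exact mul_pos_of_neg_of_neg (by linarith) h1

/-! ### Symmetric periodic orbits and their monodromy -/

namespace IsSymmetricPeriodicOrbit

variable {V u : ℝ → ℝ} {T : ℝ}

theorem isNewtonSolution (h : IsSymmetricPeriodicOrbit V T u) : IsNewtonSolution V u (deriv u) where
  hasDerivAt t := (h.contDiff.differentiable (by norm_num) t).hasDerivAt
  hasDerivAt' t := (h.contDiff.differentiable_deriv_two t).hasDerivAt.congr_deriv
    (by linarith [h.dynamics t])

theorem velocity_zero (h : IsSymmetricPeriodicOrbit V T u) : deriv u 0 = 0 := by
  have h1 := deriv_comp_neg u 0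
  rw [funext h.even, neg_zero] at h1
  linarith

theorem velocity_periodic (h : IsSymmetricPeriodicOrbit V T u) :
    Function.Periodic (deriv u) T := fun t => by
  rw [← deriv_comp_add_const, funext h.periodic]

theorem exists_abs_le (h : IsSymmetricPeriodicOrbit V T u) (hT : T ≠ 0) : ∃ R, ∀ t, |u t| ≤ R := by
  obtain ⟨R, hR⟩ := (h.periodic.isBounded_of_continuous hT h.contDiff.continuous).exists_norm_le
  exact ⟨R, fun t => hR _ ⟨t, rfl⟩⟩

/-- Time translation of the orbit: its velocity lies in the kernel of the Newton operator. -/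
theorem velocity_isHillSolution (hV : ContDiff ℝ 2 V) (h : IsSymmetricPeriodicOrbit V T u) :
    IsHillSolution (fun t => deriv (deriv V) (u t)) 0 (deriv u) (fun t => -deriv V (u t)) where
  hasDerivAt := h.isNewtonSolution.hasDerivAt'
  hasDerivAt' t := by
    refine ((hasDerivAt_deriv hV (u t)).comp t
      (h.isNewtonSolution.hasDerivAt t)).fun_neg.congr_deriv ?_
    simp only [smul_eq_mul]
    ring

variable {c c' s s' : ℝ → ℝ}

theorem velocity_eq (hV : ContDiff ℝ 2 V) (h : IsSymmetricPeriodicOrbit V T u)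
    (hb : IsHillBasis (fun t => deriv (deriv V) (u t)) 0 c c' s s') (t : ℝ) :
    deriv u t = -deriv V (u 0) * s t ∧ -deriv V (u t) = -deriv V (u 0) * s' t := by
  have := hb.eq_smul_add_smul (h.velocity_isHillSolution hV) t
  rw [h.velocity_zero] at this
  simp only [smul_eq_mul, mul_zero, zero_add] at this
  exact ⟨by rw [this.1, mul_comm], by rw [this.2, mul_comm]⟩

/-- The turning point of a non-constant orbit is not an equilibrium. -/
theorem force_ne_zero (hV : ContDiff ℝ 2 V) (h : IsSymmetricPeriodicOrbit V T u)
    (hb : IsHillBasis (fun t => deriv (deriv V) (u t)) 0 c c' s s') : deriv V (u 0) ≠ 0 := by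
  intro h0
  obtain ⟨t, ht⟩ := h.nonconstant
  refine ht (is_const_of_deriv_eq_zero (h.contDiff.differentiable (by norm_num)) (fun r => ?_) t 0)
  rw [(h.velocity_eq hV hb r).1, h0, neg_zero, zero_mul]

/-- The monodromy matrix at `E = 0` is unipotent and lower triangular. -/
theorem monodromy (hV : ContDiff ℝ 2 V) (h : IsSymmetricPeriodicOrbit V T u)
    (hb : IsHillBasis (fun t => deriv (deriv V) (u t)) 0 c c' s s') :
    c T = 1 ∧ s T = 0 ∧ s' T = 1 := by
  have hne := h.force_ne_zero hV hb
  obtain ⟨h1, h2⟩ := h.velocity_eq hV hb T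
  have hv := h.velocity_periodic 0
  have hu := h.periodic 0
  rw [zero_add] at hv hu
  rw [hv, h.velocity_zero] at h1
  rw [hu] at h2
  have hsT : s T = 0 := by
    rcases mul_eq_zero.1 h1.symm with h | h
    · exact absurd (neg_eq_zero.1 h) hne
    · exact h
  have hsT' : s' T = 1 := by
    have : -deriv V (u 0) * (s' T - 1) = 0 := by linarith
    rcases mul_eq_zero.1 this with h | h
    · exact absurd (neg_eq_zero.1 h) hne
    · linarith
  have hd := hb.det_eq_one T
  rw [hsT, hsT'] at hd
  exact ⟨by linarith, hsT, hsT'⟩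

theorem integral_sq_velocity_pos (hV : ContDiff ℝ 2 V) (h : IsSymmetricPeriodicOrbit V T u)
    (hT : 0 < T) (hb : IsHillBasis (fun t => deriv (deriv V) (u t)) 0 c c' s s') :
    0 < ∫ t in (0 : ℝ)..T, deriv u t ^ 2 := by
  have hc : Continuous (deriv u) := h.isNewtonSolution.continuous'
  refine intervalIntegral.integral_pos hT (hc.pow 2).continuousOn (fun _ _ => sq_nonneg _) ?_
  by_contra! hcon
  refine h.force_ne_zero hV hb ?_
  have hzero : ∀ t, deriv u t = 0 := fun t => by
    obtain ⟨r, hr, hrt⟩ := h.velocity_periodic.exists_mem_Ico₀ hT t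
    rw [hrt]
    exact pow_eq_zero_iff two_ne_zero |>.1
      (le_antisymm (hcon r (Set.Ico_subset_Icc_self hr)) (sq_nonneg _))
  have h1 := h.isNewtonSolution.hasDerivAt' 0
  rw [show deriv u = fun _ => (0 : ℝ) from funext hzero] at h1
  exact neg_eq_zero.1 (h1.unique (hasDerivAt_const 0 0))

/-- The amplitude of a family of orbits inherits differentiability from the energy, because the
energy is the potential at the turning point, which is a local diffeomorphism there. -/
theorem hasDerivAt_amplitude (hV : ContDiff ℝ 2 V) {ωb : ℝ} {U : ℝ → ℝ → ℝ}
    (hU : ∀ᶠ w in 𝓝 ωb, IsSymmetricPeriodicOrbit V (2 * Real.pi / w) (U w))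
    (hcont : ContinuousAt (fun w => U w 0) ωb) {dH : ℝ}
    (hH : HasDerivAt (fun w => orbitEnergy V (U w)) dH ωb) (hne : deriv V (U ωb 0) ≠ 0) :
    HasDerivAt (fun w => U w 0) ((deriv V (U ωb 0))⁻¹ * dH) ωb := by
  have hstrict : HasStrictDerivAt V (deriv V (U ωb 0)) (U ωb 0) :=
    hV.contDiffAt.hasStrictDerivAt (by norm_num)
  have hE : ∀ᶠ w in 𝓝 ωb, orbitEnergy V (U w) = V (U w 0) := by
    filter_upwards [hU] with w hw
    simp [orbitEnergy, hamiltonian, hw.velocity_zero]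
  have hV0 : HasDerivAt (fun w => V (U w 0)) dH ωb :=
    hH.congr_of_eventuallyEq (hE.mono fun _ h => h.symm)
  refine ((hstrict.to_localInverse hne).hasDerivAt.comp ωb hV0).congr_of_eventuallyEq ?_
  exact (hcont.eventually (hstrict.eventually_left_inverse hne)).mono fun _ h => h.symm

/-- The off-diagonal entry `c'(T)` of the monodromy matrix measures the variation of the energy
with the frequency. Indeed the Wronskian of `c` with the difference of the orbits of frequencies
`w` and `ωb`, taken at time `2π / w`, is `o(w - ωb)`; its derivative at `w = ωb` vanishes. -/
theorem monodromy_mul_energy_deriv (hV : ContDiff ℝ 2 V) {ωb : ℝ} (hω : 0 < ωb) {U : ℝ → ℝ → ℝ}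
    (hU : ∀ᶠ w in 𝓝 ωb, IsSymmetricPeriodicOrbit V (2 * Real.pi / w) (U w))
    (hcont : ContinuousAt (fun w => U w 0) ωb) {dH : ℝ}
    (hH : HasDerivAt (fun w => orbitEnergy V (U w)) dH ωb)
    (hb : IsHillBasis (fun t => deriv (deriv V) (U ωb t)) 0 c c' s s') :
    c' (2 * Real.pi / ωb) * dH = -(2 * Real.pi / ωb ^ 2) * deriv V (U ωb 0) ^ 2 := by
  have hu := hU.self_of_nhds
  have hne := hu.force_ne_zero hV hb
  set u := U ωb with hu_def
  set T := 2 * Real.pi / ωb with hT_def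
  have hTpos : 0 < T := by positivity
  have ha := hasDerivAt_amplitude hV hU hcont hH hne
  obtain ⟨R, hR⟩ := hu.exists_abs_le hTpos.ne'
  have hper : HasDerivAt (fun w : ℝ => 2 * Real.pi / w) (-(2 * Real.pi / ωb ^ 2)) ωb := by
    refine ((hasDerivAt_inv hω.ne').const_mul (2 * Real.pi)).congr_deriv ?_
    ring
  let φ : ℝ → ℝ := fun w => c' (2 * Real.pi / w) * (U w 0 - u (2 * Real.pi / w))
    + c (2 * Real.pi / w) * deriv u (2 * Real.pi / w)
  have huT : u T = u 0 := by simpa using hu.periodic 0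
  have hvT : deriv u T = 0 := by simpa [hu.velocity_zero] using hu.velocity_periodic 0
  have hsmall : HasDerivAt φ 0 ωb := by
    have hφ0 : φ ωb = 0 := by
      simp only [φ, ← hT_def, huT, hvT, ← hu_def, sub_self, mul_zero, add_zero]
    rw [hasDerivAt_iff_isLittleO]
    simp only [hφ0, sub_zero, smul_zero]
    refine Asymptotics.IsLittleO.trans_isBigO (g := fun w => U w 0 - u 0) ?_ ha.isBigO_sub
    refine Asymptotics.isLittleO_iff.2 fun ε hε => ?_
    obtain ⟨δ, hδ, hW⟩ := hu.isNewtonSolution.exists_wronskian_le hV hR hb.c_sol hb.c'_zero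
      (T + 1) hε
    have h1 : ∀ᶠ w in 𝓝 ωb, |U w 0 - u 0| < δ := Metric.continuousAt_iff'.1 hcont δ hδ
    have h2 : ∀ᶠ w in 𝓝 ωb, 2 * Real.pi / w < T + 1 :=
      hper.continuousAt.eventually_lt_const (by simp [hT_def])
    filter_upwards [hU, h1, h2, lt_mem_nhds hω] with w hw h1 h2 hw0
    have hUT : U w (2 * Real.pi / w) = U w 0 := by simpa using hw.periodic 0
    have hUvT : deriv (U w) (2 * Real.pi / w) = 0 := by
      simpa [hw.velocity_zero] using hw.velocity_periodic 0
    have := hW (U w) (deriv (U w)) hw.isNewtonSolution (by rw [hw.velocity_zero, hu.velocity_zero])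
      h1 (2 * Real.pi / w) ⟨by positivity, h2.le⟩
    rw [hUT, hUvT, zero_sub, mul_neg, sub_neg_eq_add] at this
    exact this
  have hcalc : HasDerivAt φ (c' T * ((deriv V (u 0))⁻¹ * dH)
      + -deriv V (u 0) * -(2 * Real.pi / ωb ^ 2)) ωb := by
    have e1 := (hb.c_sol.hasDerivAt' T).comp ωb hper
    have e2 := (hb.c_sol.hasDerivAt T).comp ωb hper
    have e3 := (hu.isNewtonSolution.hasDerivAt T).comp ωb hper
    have e4 := (hu.isNewtonSolution.hasDerivAt' T).comp ωb hper
    refine ((e1.mul (ha.sub e3)).add (e2.mul e4)).congr_deriv ?_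
    simp only [Function.comp_apply, Pi.sub_apply, ← hT_def, ← hu_def, huT, hvT,
      (hu.monodromy hV hb).1]
    ring
  have := hcalc.unique hsmall
  field_simp at this ⊢
  linarith

end IsSymmetricPeriodicOrbit

/-- For a unipotent lower triangular monodromy matrix, the reflection `t ↦ T - t` evaluates the
overlap of the two fundamental solutions. -/
theorem IsHillBasis.integral_mul_eq {q : ℝ → ℝ} {E T : ℝ} {c c' s s' : ℝ → ℝ}
    (h : IsHillBasis q E c c' s s') (hq : ∀ t, q (-t) = q t) (hT : Function.Periodic q T)
    (hc : c T = 1) (hs : s T = 0) (hs' : s' T = 1) :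
    ∫ t in (0 : ℝ)..T, c t * s t = c' T / 2 * ∫ t in (0 : ℝ)..T, s t ^ 2 := by
  have hpt : ∀ t, c (T - t) * s (T - t) = c' T * s t ^ 2 - c t * s t := fun t => by
    have h1 := (h.eq_smul_add_smul (h.c_sol.comp_add_const hT) (-t)).1
    have h2 := (h.eq_smul_add_smul (h.s_sol.comp_add_const hT) (-t)).1
    obtain ⟨e1, -, e3, -⟩ := h.even_odd hq t
    simp only [zero_add, hc, hs, hs', e1, e3, smul_eq_mul, neg_add_eq_sub] at h1 h2
    rw [h1, h2]
    ring
  have hcc := h.c_sol.continuous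
  have hsc := h.s_sol.continuous
  have hi : Continuous fun t => c' T * s t ^ 2 := continuous_const.mul (hsc.pow 2)
  have hi' : Continuous fun t => c t * s t := hcc.mul hsc
  have hrefl := intervalIntegral.integral_comp_sub_left (a := 0) (b := T) (fun t => c t * s t) T
  simp only [hpt, sub_self, sub_zero] at hrefl
  rw [intervalIntegral.integral_sub (hi.intervalIntegrable _ _)
    (hi'.intervalIntegrable _ _), intervalIntegral.integral_const_mul] at hrefl
  linarith

end BandCurvature

/-! ### The curvature of the band -/

/-- `U w` is the family of time-symmetric periodic orbits parametrized by the frequency `w` near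
`ωb`, with energy `H(w)`; `u = U ωb` is the given orbit, and `dH` is `dH/dω` at `ωb`. -/
theorem mainTheorem4 (V : ℝ → ℝ) (hV : ContDiff ℝ 2 V) (ωb : ℝ) (hω : 0 < ωb) (u : ℝ → ℝ)
    (hu : BandCurvature.IsSymmetricPeriodicOrbit V (2 * Real.pi / ωb) u)
    (U : ℝ → ℝ → ℝ) (hUu : U ωb = u)
    (hU : ∀ᶠ w in 𝓝 ωb, BandCurvature.IsSymmetricPeriodicOrbit V (2 * Real.pi / w) (U w))
    (hcont : ContinuousAt (fun w => U w 0) ωb)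
    (dH : ℝ) (hH : HasDerivAt (fun w => BandCurvature.orbitEnergy V (U w)) dH ωb)
    (I : ℝ) (hI : I = ∫ t in (0 : ℝ)..(2 * Real.pi / ωb), (deriv u t) ^ 2) :
    0 < I ∧
    ∃ E : ℝ → ℝ,
      -- near `(0, 0)` the band set is exactly the graph of `E`, which passes through `(0, 0)`
      (∀ᶠ p : ℝ × ℝ in 𝓝 (0, 0),
        p ∈ BandCurvature.bandSet V u (2 * Real.pi / ωb) hu.periodic ↔ p.2 = E p.1) ∧
      E 0 = 0 ∧
      -- the band is symmetric, tangent to the axis `E = 0`, with the stated second derivative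
      (∀ᶠ θ in 𝓝 (0 : ℝ), E (-θ) = E θ) ∧
      (∀ᶠ θ in 𝓝 (0 : ℝ), DifferentiableAt ℝ E θ) ∧
      deriv E 0 = 0 ∧
      HasDerivAt (deriv E) (-(ωb ^ 2 / (Real.pi * I)) * dH) 0 ∧
      -- hard potentials: negative curvature, tangent from below
      (0 < dH → deriv (deriv E) 0 < 0 ∧ ∀ᶠ θ in 𝓝[≠] (0 : ℝ), E θ < 0) ∧
      -- soft potentials: positive curvature, tangent from above
      (dH < 0 → 0 < deriv (deriv E) 0 ∧ ∀ᶠ θ in 𝓝[≠] (0 : ℝ), 0 < E θ) := by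
  subst hUu
  have hT : 0 < 2 * Real.pi / ωb := by positivity
  have hcu : Continuous (U ωb) := hu.contDiff.continuous
  have hq : Continuous fun t => deriv (deriv V) (U ωb t) :=
    (BandCurvature.continuous_deriv_deriv hV).comp hcu
  have hqT : Function.Periodic (fun t => deriv (deriv V) (U ωb t)) (2 * Real.pi / ωb) :=
    fun t => by simp only [hu.periodic t]
  obtain ⟨M, hM⟩ := (hqT.isBounded_of_continuous hT.ne' hq).exists_norm_le
  have hM' : ∀ t, |deriv (deriv V) (U ωb t)| ≤ M := fun t => hM _ ⟨t, rfl⟩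
  obtain ⟨c, c', hc, hc0, hc0', hcc⟩ := BandCurvature.exists_hillSolution_family hq hM' 1 0
  obtain ⟨s, s', hs, hs0, hs0', hsc⟩ := BandCurvature.exists_hillSolution_family hq hM' 0 1
  have hb : ∀ E ∈ Set.Icc (-1 : ℝ) 1, BandCurvature.IsHillBasis
      (fun t => deriv (deriv V) (U ωb t)) E (c E) (c' E) (s E) (s' E) := fun E hE =>
    ⟨hc E hE, hs E hE, hc0 E, hc0' E, hs0 E, hs0' E⟩
  have hb0 := hb 0 (by norm_num)
  have hIpos : 0 < I := hI ▸ hu.integral_sq_velocity_pos hV hT hb0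
  have hne := hu.force_ne_zero hV hb0
  obtain ⟨hcT, hsT, hsT'⟩ := hu.monodromy hV hb0
  have hmono := BandCurvature.IsSymmetricPeriodicOrbit.monodromy_mul_energy_deriv hV hω hU hcont
    hH hb0
  have hover := hb0.integral_mul_eq (fun t => by simp only [hu.even t]) hqT hcT hsT hsT'
  have hIs : I = deriv V (U ωb 0) ^ 2 * ∫ t in (0 : ℝ)..(2 * Real.pi / ωb), s 0 t ^ 2 := by
    rw [hI, ← intervalIntegral.integral_const_mul]
    refine intervalIntegral.integral_congr fun t _ => ?_
    simp only [(hu.velocity_eq hV hb0 t).1]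
    ring
  set T := 2 * Real.pi / ωb with hT_def
  set D' : ℝ → ℝ := fun E => s E T * (∫ t in (0 : ℝ)..T, c E t * c E t)
    - c E T * ∫ t in (0 : ℝ)..T, c E t * s E t with hD'
  -- This product is positive, so neither `D' 0` nor `dH` vanishes, and they have the same sign.
  have hslope : D' 0 * dH = Real.pi * I / ωb ^ 2 := by
    have h1 : D' 0 = -(c' 0 T / 2 * ∫ t in (0 : ℝ)..T, s 0 t ^ 2) := by
      simp only [hD', hcT, hsT, hover]
      ring
    rw [h1, hIs]
    linear_combination (-1 / 2 * ∫ t in (0 : ℝ)..T, s 0 t ^ 2) * hmono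
  have hslope_pos : 0 < D' 0 * dH := by rw [hslope]; positivity
  have hκ : D' 0 ≠ 0 := left_ne_zero_of_mul hslope_pos.ne'
  have hcurv : -(D' 0)⁻¹ = -(ωb ^ 2 / (Real.pi * I)) * dH := by
    have hpi := Real.pi_pos
    field_simp at hslope ⊢
    linarith
  obtain ⟨E, hE1, hE2, hE3, hE4, hE5, hE6, hE7, hE8⟩ := BandCurvature.exists_band_function
    (D := fun E => c E T) (B := BandCurvature.bandSet V (U ωb) T hu.periodic)
    (fun E hE => BandCurvature.hasDerivAt_halfDiscriminant hb hcc T hE)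
    (BandCurvature.continuous_deriv_halfDiscriminant hcc hsc T) hcT hκ
    (fun θ E hE => BandCurvature.mem_bandSet_iff hu.periodic hu.even hq
      (hb E (Set.Ioo_subset_Icc_self hE)) θ)
  refine ⟨hIpos, E, hE1, hE2, .of_forall hE3, hE4, hE5, hcurv ▸ hE6, fun hpos => ?_, fun hneg => ?_⟩
  · have : 0 < D' 0 := pos_of_mul_pos_left hslope_pos hpos.le
    exact ⟨hE6.deriv ▸ neg_lt_zero.2 (inv_pos.2 this), hE7 this⟩
  · have : D' 0 < 0 := by
      by_contra! h
      exact absurd hslope_pos (not_lt.2 (mul_nonpos_of_nonneg_of_nonpos h hneg.le))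
    exact ⟨hE6.deriv ▸ neg_pos.2 (inv_lt_zero.2 this), hE8 this⟩
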